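/- **Setting.** Let $\mathbf z=(\mathbf z_1,\dots,\mathbf z_N)$ be a random vector with values in an open, simply connected product $\mathcal Z=\mathcal Z_1\times\dots\times\mathcal Z_N\subseteq\mathbb R^N$, with a probability density $p_{\mathbf z}$ that is smooth on $\mathcal Z$ and positive almost everywhere on $\mathcal Z$. For $A\subseteq[N]$ write $\mathbf z_A=(\mathbf z_j)_{j\in A}$ and $\mathcal Z_A=\prod_{j\in A}\mathcal Z_j$. There are $K$ views $\mathbf x_k=f_k(\mathbf z_{S_k})$, $k\in[K]$, where $S_k\subseteq[N]$ and $f_k:\mathcal Z_{S_k}\to\mathcal X_k\subseteq\mathbb R^{D_k}$ is a diffeomorphism. Such data are called a *latent model*. A smooth map $g:\mathcal X_k\to\mathbb R^{|A|}$ *block-identifies* $\mathbf z_A$ (from the view $\mathbf x_k$) if there is a diffeomorphism $h$ from $\mathcal Z_A$ onto a subset of $\mathbb R^{|A|}$ such that $g(\mathbf x_k)=h(\mathbf z_A)$ for all $\mathbf z\in\mathcal Z$. **Corollary (Identifiability Algebra: Intersection).** Let $C_1,C_2\subseteq[N]$ and suppose that, in a given latent model, $\mathbf z_{C_1}$ and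 $\mathbf z_{C_2}$ are block-identified by smooth encoders $g_1$ and $g_2$ of the views $\mathbf x_{k_1}$ and $\mathbf x_{k_2}$ ($k_1=k_2$ is allowed). Then $\mathbf z_{C_1\cap C_2}$ can be block-identified from the two learned representations $g_1(\mathbf x_{k_1})$ and $g_2(\mathbf x_{k_2})$: there are smooth maps $\gamma_i:g_i(\mathcal X_{k_i})\to\mathbb R^{|C_1\cap C_2|}$, $i=1,2$, such that $\gamma_1\circ g_1$ and $\gamma_2\circ g_2$ both block-identify $\mathbf z_{C_1\cap C_2}$. Moreover, $\gamma_1,\gamma_2$ can be chosen in terms of the learned representations alone: they work for every latent model that explains the same representations. That is, for every latent model (with any number of latents and views, any latent space, density, index sets and mixing functions), any index sets $C_1',C_2'$ of its latents and any smooth encoders $g_1',g_2'$ of two of its views $\mathbf x'_{k_1'},\mathbf x'_{k_2'}$ that block-identify $\mathbf z'_{C_1'}$ and $\mathbf z'_{C_2'}$, with the same ranges $g_i'(\mathcal X'_{k_i'})=g_i(\mathcal X_{k_i})$, $i=1,2$, and the same joint distribution of $(g_1'(\mathbf x'_{k_1'}),g_2'(\mathbf x'_{k_2'}))$ as of $(g_1(\mathbf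 x_{k_1}),g_2(\mathbf x_{k_2}))$, the maps $\gamma_1\circ g_1'$ and $\gamma_2\circ g_2'$ both block-identify $\mathbf z'_{C_1'\cap C_2'}$. -/

import Mathlib

/-!
Write `r₁ z` and `r₂ z` for the two representations of the latent vector `z`. As the latent space is
a box, the pair `(r₁ z, r₂ w)` is attained by a single latent vector iff `z` and `w` agree on
`C₁ ∩ C₂`. Hence `z` and `w` agree on `C₁ ∩ C₂` iff some `y` makes both `(r₁ z, y)` and `(r₁ w, y)`
attainable, a condition which involves the latents only through the set of attainable pairs. So two
models with the same set of attainable pairs have the same fibres of the shared block, and a map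
which decodes this block in one of them decodes it in the other.

The set of attainable pairs is observable: the latent law has full support, so the support of the
joint law of the representations is the closure of this set, and the set is relatively closed in the
product of the two ranges, where it is cut out by the equality of two decoded shared blocks.
-/

open MeasureTheory Set
open scoped ContDiff

/-- `f` restricts to a smooth diffeomorphism from `s` onto `t`: a smooth bijection whose inverse is
smooth on `t`. The set `t` need not be open: it may be a lower-dimensional submanifold of `F`. -/
def IsDiffeoOn {E F : Type*} [NormedAddCommGroup E] [NormedSpace ℝ E]
    [NormedAddCommGroup F] [NormedSpace ℝ F] (f : E → F) (s : Set E) (t : Set F) : Prop :=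
  BijOn f s t ∧ ContDiffOn ℝ ∞ f s ∧
    ∃ f' : F → E, LeftInvOn f' f s ∧ ContDiffOn ℝ ∞ f' t

/-- A multi-view latent variable model with `N` real latent variables and `K` views, the `k`-th view
taking values in `ℝ ^ (D k)`. -/
structure LatentModel (N K : ℕ) (D : Fin K → ℕ) where
  /-- the range of each single latent variable -/
  factor : Fin N → Set ℝ
  /-- the density of the latent vector -/
  density : (Fin N → ℝ) → ℝ
  /-- the indices of the view-specific latents -/
  S : Fin K → Finset (Fin N)
  /-- the observation spaces -/
  X : (k : Fin K) → Set (Fin (D k) → ℝ)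
  /-- the view-specific mixing functions -/
  f : (k : Fin K) → (S k → ℝ) → (Fin (D k) → ℝ)
  isOpen_latent : IsOpen (univ.pi factor)
  simplyConnected_latent : SimplyConnectedSpace (univ.pi factor)
  density_smooth : ContDiffOn ℝ ∞ density (univ.pi factor)
  density_pos : ∀ᵐ z ∂(volume.restrict (univ.pi factor)), 0 < density z
  density_total : ∫⁻ z in univ.pi factor, ENNReal.ofReal (density z) = 1
  mixing_diffeo : ∀ k, IsDiffeoOn (f k) (univ.pi fun j : S k => factor j) (X k)

namespace LatentModel

variable {N K : ℕ} {D : Fin K → ℕ}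

/-- The latent space, the product of the ranges of the latent variables. -/
def latentSpace (M : LatentModel N K D) : Set (Fin N → ℝ) := univ.pi M.factor

/-- The latent subspace in which the block `z_A` takes its values. -/
def blockSpace (M : LatentModel N K D) (A : Finset (Fin N)) : Set (A → ℝ) :=
  univ.pi fun j : A => M.factor j

/-- The distribution of the latent vector. -/
noncomputable def latentLaw (M : LatentModel N K D) : Measure (Fin N → ℝ) :=
  (volume.restrict M.latentSpace).withDensity fun z => ENNReal.ofReal (M.density z)

/-- The `k`-th view `x_k = f_k (z_{S_k})` as a function of the latent vector. -/
def view (M : LatentModel N K D) (k : Fin K) (z : Fin N → ℝ) : Fin (D k) → ℝ :=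
  M.f k ((M.S k).restrict z)

/-- The smooth encoder `g` of the `k`-th view block-identifies the latent block `z_A`: its values
have the dimension of `z_A`, and `g (x_k) = h (z_A)` for a smooth invertible mapping `h`. -/
def BlockIdentifies (M : LatentModel N K D) (k : Fin K) (A : Finset (Fin N)) {m : ℕ}
    (g : (Fin (D k) → ℝ) → (Fin m → ℝ)) : Prop :=
  m = A.card ∧ ContDiffOn ℝ ∞ g (M.X k) ∧
    ∃ h : (A → ℝ) → (Fin m → ℝ), IsDiffeoOn h (M.blockSpace A) (h '' M.blockSpace A) ∧
      ∀ z ∈ M.latentSpace, g (M.view k z) = h (A.restrict z)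

/-- The joint distribution of the representations `g₁ (x_{k₁})` and `g₂ (x_{k₂})`. -/
noncomputable def reprLaw (M : LatentModel N K D) (k₁ k₂ : Fin K) {m₁ m₂ : ℕ}
    (g₁ : (Fin (D k₁) → ℝ) → (Fin m₁ → ℝ)) (g₂ : (Fin (D k₂) → ℝ) → (Fin m₂ → ℝ)) :
    Measure ((Fin m₁ → ℝ) × (Fin m₂ → ℝ)) :=
  M.latentLaw.map fun z => (g₁ (M.view k₁ z), g₂ (M.view k₂ z))

end LatentModel

theorem IsDiffeoOn.exists_symm {E F : Type*} [NormedAddCommGroup E] [NormedSpace ℝ E]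
    [NormedAddCommGroup F] [NormedSpace ℝ F] {f : E → F} {s : Set E} {t : Set F}
    (hf : IsDiffeoOn f s t) : ∃ f' : F → E, IsDiffeoOn f' t s := by
  obtain ⟨hbij, hsmooth, f', hinv, hsmooth'⟩ := hf
  have hinv' : LeftInvOn f f' t := by
    rw [← hbij.image_eq]
    rintro _ ⟨x, hx, rfl⟩
    rw [hinv hx]
  exact ⟨f', hbij.symm ⟨hinv', hinv⟩, hsmooth', f, hinv', hsmooth⟩

theorem IsDiffeoOn.comp {E F G : Type*} [NormedAddCommGroup E] [NormedSpace ℝ E]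
    [NormedAddCommGroup F] [NormedSpace ℝ F] [NormedAddCommGroup G] [NormedSpace ℝ G]
    {g : F → G} {f : E → F} {s : Set E} {t : Set F} {u : Set G}
    (hg : IsDiffeoOn g t u) (hf : IsDiffeoOn f s t) : IsDiffeoOn (g ∘ f) s u := by
  obtain ⟨hgbij, hgsmooth, g', hginv, hgsmooth'⟩ := hg
  obtain ⟨hfbij, hfsmooth, f', hfinv, hfsmooth'⟩ := hf
  refine ⟨hgbij.comp hfbij, hgsmooth.comp hfsmooth hfbij.mapsTo, f' ∘ g',
    hfinv.comp hginv hfbij.mapsTo, hfsmooth'.comp hgsmooth' ?_⟩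
  rw [← hgbij.image_eq]
  exact (mapsTo_image_iff.2 fun x hx => by rwa [Function.comp_apply, hginv hx])

theorem IsDiffeoOn.finrank_le {E F : Type*} [NormedAddCommGroup E] [NormedSpace ℝ E]
    [NormedAddCommGroup F] [NormedSpace ℝ F] [FiniteDimensional ℝ F] {f : E → F} {s : Set E}
    {t : Set F} (hf : IsDiffeoOn f s t) (hs : IsOpen s) (hne : s.Nonempty) :
    Module.finrank ℝ E ≤ Module.finrank ℝ F := by
  obtain ⟨hbij, hsmooth, f', hinv, hsmooth'⟩ := hf
  obtain ⟨x, hx⟩ := hne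
  have hd : HasFDerivWithinAt f (fderivWithin ℝ f s x) s x :=
    (hsmooth.differentiableOn (by simp) x hx).hasFDerivWithinAt
  have hd' : HasFDerivWithinAt f' (fderivWithin ℝ f' t (f x)) t (f x) :=
    (hsmooth'.differentiableOn (by simp) _ (hbij.mapsTo hx)).hasFDerivWithinAt
  have hid : HasFDerivWithinAt (f' ∘ f) (ContinuousLinearMap.id ℝ E) s x :=
    (hasFDerivWithinAt_id x s).congr hinv (hinv hx)
  have hcomp : (fderivWithin ℝ f' t (f x)).comp (fderivWithin ℝ f s x) = .id ℝ E :=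
    (hs.uniqueDiffWithinAt hx).eq (hd'.comp x hd hbij.mapsTo) hid
  exact LinearMap.finrank_le_finrank_of_injective (f := (fderivWithin ℝ f s x : E →ₗ[ℝ] F))
    (Function.LeftInverse.injective (DFunLike.congr_fun hcomp))

theorem IsDiffeoOn.finrank_eq {E F : Type*} [NormedAddCommGroup E] [NormedSpace ℝ E]
    [FiniteDimensional ℝ E] [NormedAddCommGroup F] [NormedSpace ℝ F] [FiniteDimensional ℝ F]
    {f : E → F} {s : Set E} {t : Set F} (hf : IsDiffeoOn f s t) (hs : IsOpen s) (ht : IsOpen t)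
    (hne : s.Nonempty) : Module.finrank ℝ E = Module.finrank ℝ F := by
  obtain ⟨f', hf'⟩ := hf.exists_symm
  exact le_antisymm (hf.finrank_le hs hne) (hf'.finrank_le ht (hf.1.image_eq ▸ hne.image f))

section Box

variable {ι : Type*} {E : ι → Type*} {s : ∀ i, Set (E i)}

theorem restrict_mem_univ_pi {z : ∀ i, E i} (hz : z ∈ univ.pi s) (A : Finset ι) :
    A.restrict z ∈ univ.pi fun i : A => s i :=
  fun i _ => hz i (mem_univ _)

theorem updateFinset_mem_univ_pi [DecidableEq ι] {A : Finset ι} {z : ∀ i, E i}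
    (hz : z ∈ univ.pi s) {v : ∀ i : A, E i} (hv : v ∈ univ.pi fun i : A => s i) :
    Function.updateFinset z A v ∈ univ.pi s := by
  intro i _
  by_cases h : i ∈ A
  · simpa [Function.updateFinset, h] using hv ⟨i, h⟩ (mem_univ _)
  · simpa [Function.updateFinset, h] using hz i (mem_univ _)

theorem image_restrict_univ_pi (hne : (univ.pi s).Nonempty) (A : Finset ι) :
    A.restrict '' univ.pi s = univ.pi fun i : A => s i := by
  classical
  obtain ⟨z, hz⟩ := hne
  refine Subset.antisymm (image_subset_iff.2 fun w hw => restrict_mem_univ_pi hw A) fun v hv => ?_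
  exact ⟨_, updateFinset_mem_univ_pi hz hv, Function.restrict_updateFinset z v⟩

theorem contDiff_updateFinset [Fintype ι] [DecidableEq ι] [∀ i, NormedAddCommGroup (E i)]
    [∀ i, NormedSpace ℝ (E i)] {n : WithTop ℕ∞} (z : ∀ i, E i) (A : Finset ι) :
    ContDiff ℝ n (Function.updateFinset z A) := by
  refine contDiff_pi.2 fun i => ?_
  by_cases h : i ∈ A
  · simp only [Function.updateFinset, h, dif_pos]
    exact (ContinuousLinearMap.proj (R := ℝ) (φ := fun i : A => E i) ⟨i, h⟩).contDiff
  · simpa [Function.updateFinset, h] using contDiff_const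

end Box

section JointRange

variable {X F₁ F₂ : Type*}

/-- The set of pairs of values which `r₁` and `r₂` attain at a common point of `P`. It is all that a
pair of representations reveals about the latent variables. -/
def jointRange (P : Set X) (r₁ : X → F₁) (r₂ : X → F₂) : Set (F₁ × F₂) :=
  (fun z => (r₁ z, r₂ z)) '' P

theorem image_fst_jointRange (P : Set X) (r₁ : X → F₁) (r₂ : X → F₂) :
    Prod.fst '' jointRange P r₁ r₂ = r₁ '' P :=
  image_image ..

theorem image_eq_of_jointRange_eq {X' : Type*} {P : Set X} {P' : Set X'} {r₁ : X → F₁}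
    {r₂ : X → F₂} {r₁' : X' → F₁} {r₂' : X' → F₂}
    (h : jointRange P' r₁' r₂' = jointRange P r₁ r₂) : r₁' '' P' = r₁ '' P := by
  rw [← image_fst_jointRange P' r₁' r₂', h, image_fst_jointRange]

theorem image_swap_jointRange (P : Set X) (r₁ : X → F₁) (r₂ : X → F₂) :
    Prod.swap '' jointRange P r₁ r₂ = jointRange P r₂ r₁ :=
  image_image ..

theorem jointRange_subset_prod (P : Set X) (r₁ : X → F₁) (r₂ : X → F₂) :
    jointRange P r₁ r₂ ⊆ (r₁ '' P) ×ˢ (r₂ '' P) :=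
  image_subset_iff.2 fun _ hz => ⟨mem_image_of_mem _ hz, mem_image_of_mem _ hz⟩

end JointRange

section EncodesBlock

variable {ι : Type*} {E : ι → Type*} [∀ i, NormedAddCommGroup (E i)]
  [∀ i, NormedSpace ℝ (E i)] {F : Type*} [NormedAddCommGroup F] [NormedSpace ℝ F]

/-- On the box `univ.pi s`, the map `r` is a diffeomorphic function of the coordinates in `A`. This
is the part of `LatentModel.BlockIdentifies` which concerns only the representation `r = g ∘ x_k` as
a function of the latents; the dimension of its values is left free. -/
def EncodesBlock (s : ∀ i, Set (E i)) (A : Finset ι) (r : (∀ i, E i) → F) : Prop :=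
  ∃ φ : (∀ i : A, E i) → F,
    IsDiffeoOn φ (univ.pi fun i : A => s i) (φ '' univ.pi fun i : A => s i) ∧
      ∀ z ∈ univ.pi s, r z = φ (A.restrict z)

variable {s : ∀ i, Set (E i)} {A B : Finset ι} {r : (∀ i, E i) → F}

namespace EncodesBlock

theorem contDiffOn [Fintype ι] (h : EncodesBlock s A r) : ContDiffOn ℝ ∞ r (univ.pi s) := by
  obtain ⟨φ, hφ, hr⟩ := h
  have hrestrict : ContDiff ℝ ∞ (A.restrict : (∀ i, E i) → ∀ i : A, E i) :=
    contDiff_pi.2 fun i => (ContinuousLinearMap.proj (R := ℝ) (φ := E) i).contDiff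
  exact (hφ.2.1.comp hrestrict.contDiffOn fun z hz => restrict_mem_univ_pi hz A).congr hr

theorem eq_iff (h : EncodesBlock s A r) {z w : ∀ i, E i} (hz : z ∈ univ.pi s)
    (hw : w ∈ univ.pi s) : r z = r w ↔ ∀ i ∈ A, z i = w i := by
  obtain ⟨φ, hφ, hr⟩ := h
  rw [hr z hz, hr w hw,
    hφ.1.injOn.eq_iff (restrict_mem_univ_pi hz A) (restrict_mem_univ_pi hw A)]
  simp [funext_iff]

theorem exists_isDiffeoOn (h : EncodesBlock s A r) (hne : (univ.pi s).Nonempty) :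
    ∃ φ : (∀ i : A, E i) → F, IsDiffeoOn φ (univ.pi fun i : A => s i) (r '' univ.pi s) := by
  obtain ⟨φ, hφ, hr⟩ := h
  refine ⟨φ, ?_⟩
  rwa [image_congr hr, ← image_image φ, image_restrict_univ_pi hne]

theorem finrank_eq {ι' : Type*} {E' : ι' → Type*} [∀ i, NormedAddCommGroup (E' i)]
    [∀ i, NormedSpace ℝ (E' i)] [∀ i, FiniteDimensional ℝ (E i)]
    [∀ i, FiniteDimensional ℝ (E' i)] {s' : ∀ i, Set (E' i)} {A' : Finset ι'}
    {r' : (∀ i, E' i) → F} (h : EncodesBlock s A r) (h' : EncodesBlock s' A' r')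
    (hs : ∀ i, IsOpen (s i)) (hs' : ∀ i, IsOpen (s' i)) (hne : (univ.pi s).Nonempty)
    (hrange : r '' univ.pi s = r' '' univ.pi s') :
    Module.finrank ℝ (∀ i : A, E i) = Module.finrank ℝ (∀ i : A', E' i) := by
  have hne' : (univ.pi s').Nonempty := image_nonempty.1 (hrange ▸ hne.image r)
  obtain ⟨φ, hφ⟩ := h.exists_isDiffeoOn hne
  obtain ⟨φ', hφ'⟩ := h'.exists_isDiffeoOn hne'
  obtain ⟨ψ, hψ⟩ := hφ'.exists_symm
  rw [hrange] at hφ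
  refine (hψ.comp hφ).finrank_eq (isOpen_set_pi finite_univ fun i _ => hs i)
    (isOpen_set_pi finite_univ fun i _ => hs' i) ?_
  exact image_restrict_univ_pi hne A ▸ hne.image _

theorem exists_decoder (h : EncodesBlock s A r) :
    ∃ q : F → ∀ i : A, E i, ContDiffOn ℝ ∞ q (r '' univ.pi s) ∧
      ∀ z ∈ univ.pi s, q (r z) = A.restrict z := by
  obtain ⟨φ, ⟨-, -, q, hinv, hq⟩, hr⟩ := h
  refine ⟨q, hq.mono ?_, fun z hz => ?_⟩
  · exact image_subset_iff.2 fun z hz => ⟨_, restrict_mem_univ_pi hz A, (hr z hz).symm⟩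
  · rw [hr z hz, hinv (restrict_mem_univ_pi hz A)]

theorem exists_section [Fintype ι] (h : EncodesBlock s A r) (hne : (univ.pi s).Nonempty) :
    ∃ σ : F → ∀ i, E i, ContDiffOn ℝ ∞ σ (r '' univ.pi s) ∧
      MapsTo σ (r '' univ.pi s) (univ.pi s) ∧ LeftInvOn r σ (r '' univ.pi s) := by
  classical
  obtain ⟨q, hq, hqr⟩ := h.exists_decoder
  obtain ⟨z₀, hz₀⟩ := hne
  have hmaps : ∀ z ∈ univ.pi s, Function.updateFinset z₀ A (q (r z)) ∈ univ.pi s := fun z hz =>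
    updateFinset_mem_univ_pi hz₀ (hqr z hz ▸ restrict_mem_univ_pi hz A)
  refine ⟨fun y => Function.updateFinset z₀ A (q y),
    (contDiff_updateFinset z₀ A).comp_contDiffOn hq, mapsTo_image_iff.2 hmaps, ?_⟩
  rintro _ ⟨z, hz, rfl⟩
  refine (h.eq_iff (hmaps z hz) hz).2 fun i hi => ?_
  simp [hqr z hz, Function.updateFinset, hi]

theorem of_decoder [Fintype ι] (hne : (univ.pi s).Nonempty) (hr : ContDiffOn ℝ ∞ r (univ.pi s))
    (hdep : ∀ z ∈ univ.pi s, ∀ w ∈ univ.pi s, (∀ i ∈ A, z i = w i) → r z = r w)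
    {q : F → ∀ i : A, E i} (hq : ContDiffOn ℝ ∞ q (r '' univ.pi s))
    (hqr : ∀ z ∈ univ.pi s, q (r z) = A.restrict z) : EncodesBlock s A r := by
  classical
  obtain ⟨z₀, hz₀⟩ := hne
  have hext : MapsTo (Function.updateFinset z₀ A) (univ.pi fun i : A => s i) (univ.pi s) :=
    fun v hv => updateFinset_mem_univ_pi hz₀ hv
  have hinv : LeftInvOn q (r ∘ Function.updateFinset z₀ A) (univ.pi fun i : A => s i) :=
    fun v hv => (hqr _ (hext hv)).trans (Function.restrict_updateFinset z₀ v)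
  refine ⟨r ∘ Function.updateFinset z₀ A, ⟨hinv.injOn.bijOn_image,
    hr.comp (contDiff_updateFinset z₀ A).contDiffOn hext, q, hinv, hq.mono ?_⟩, fun z hz => ?_⟩
  · exact image_comp r _ _ ▸ image_mono hext.image_subset
  · refine hdep z hz _ (hext (restrict_mem_univ_pi hz A)) fun i hi => ?_
    simp [Function.updateFinset, hi]

theorem exists_comp_of_subset {G : Type*} [NormedAddCommGroup G] [NormedSpace ℝ G]
    (h : EncodesBlock s A r) (hBA : B ⊆ A) (e : (∀ i : B, E i) ≃L[ℝ] G) :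
    ∃ γ : F → G, ContDiffOn ℝ ∞ γ (r '' univ.pi s) ∧ EncodesBlock s B (γ ∘ r) := by
  obtain ⟨q, hq, hqr⟩ := h.exists_decoder
  refine ⟨fun y => e (Finset.restrict₂ hBA (q y)), ?_, e, ⟨e.injective.injOn.bijOn_image,
    e.contDiff.contDiffOn, e.symm, fun v _ => e.symm_apply_apply v, e.symm.contDiff.contDiffOn⟩,
    fun z hz => ?_⟩
  · exact e.contDiff.comp_contDiffOn (contDiffOn_pi.2 fun i => contDiffOn_pi.1 hq ⟨i, hBA i.2⟩)
  · simp only [Function.comp_apply, hqr z hz, ]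
    rfl

section Pair

variable {F₁ F₂ : Type*} [NormedAddCommGroup F₁] [NormedSpace ℝ F₁] [NormedAddCommGroup F₂]
  [NormedSpace ℝ F₂] {r₁ : (∀ i, E i) → F₁} {r₂ : (∀ i, E i) → F₂}

theorem mem_jointRange_iff [DecidableEq ι] (h₁ : EncodesBlock s A r₁) (h₂ : EncodesBlock s B r₂)
    {z w : ∀ i, E i} (hz : z ∈ univ.pi s) (hw : w ∈ univ.pi s) :
    (r₁ z, r₂ w) ∈ jointRange (univ.pi s) r₁ r₂ ↔ ∀ i ∈ A ∩ B, z i = w i := by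
  constructor
  · rintro ⟨u, hu, huzw⟩
    obtain ⟨huz, huw⟩ := Prod.mk.inj huzw
    intro i hi
    rw [← (h₁.eq_iff hu hz).1 huz i (Finset.mem_of_mem_inter_left hi),
      (h₂.eq_iff hu hw).1 huw i (Finset.mem_of_mem_inter_right hi)]
  · intro hzw
    have hu : A.piecewise z w ∈ univ.pi s := A.piecewise_mem_set_pi hz hw
    refine ⟨_, hu, Prod.ext ((h₁.eq_iff hu hz).2 fun i hi => ?_)
      ((h₂.eq_iff hu hw).2 fun i hi => ?_)⟩
    · exact A.piecewise_eq_of_mem z w hi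
    · by_cases hiA : i ∈ A
      · rw [A.piecewise_eq_of_mem z w hiA, hzw i (Finset.mem_inter_of_mem hiA hi)]
      · exact A.piecewise_eq_of_notMem z w hiA

theorem exists_mem_jointRange_iff [DecidableEq ι] (h₁ : EncodesBlock s A r₁)
    (h₂ : EncodesBlock s B r₂) {z w : ∀ i, E i} (hz : z ∈ univ.pi s) (hw : w ∈ univ.pi s) :
    (∃ y, (r₁ z, y) ∈ jointRange (univ.pi s) r₁ r₂ ∧ (r₁ w, y) ∈ jointRange (univ.pi s) r₁ r₂) ↔
      ∀ i ∈ A ∩ B, z i = w i := by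
  constructor
  · rintro ⟨_, ⟨u, hu, huy⟩, hwy⟩
    obtain ⟨huz, rfl⟩ := Prod.mk.inj huy
    intro i hi
    rw [(h₁.mem_jointRange_iff h₂ hw hu).1 hwy i hi,
      (h₁.eq_iff hu hz).1 huz i (Finset.mem_of_mem_inter_left hi)]
  · intro hzw
    exact ⟨r₂ z, mem_image_of_mem _ hz,
      (h₁.mem_jointRange_iff h₂ hw hz).2 fun i hi => (hzw i hi).symm⟩

theorem closure_jointRange_inter_prod (h₁ : EncodesBlock s A r₁) (h₂ : EncodesBlock s B r₂) :
    closure (jointRange (univ.pi s) r₁ r₂) ∩ (r₁ '' univ.pi s) ×ˢ (r₂ '' univ.pi s) =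
      jointRange (univ.pi s) r₁ r₂ := by
  classical
  obtain ⟨q₁, hq₁, hqr₁⟩ := h₁.exists_decoder
  obtain ⟨q₂, hq₂, hqr₂⟩ := h₂.exists_decoder
  have hA : A ∩ B ⊆ A := Finset.inter_subset_left
  have hB : A ∩ B ⊆ B := Finset.inter_subset_right
  have hsub := subset_inter subset_closure (jointRange_subset_prod (univ.pi s) r₁ r₂)
  refine Subset.antisymm ?_ hsub
  have hdecoded : EqOn (fun p : F₁ × F₂ => Finset.restrict₂ hA (q₁ p.1))
      (fun p => Finset.restrict₂ hB (q₂ p.2)) (jointRange (univ.pi s) r₁ r₂) := by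
    rintro _ ⟨z, hz, rfl⟩
    simp only [hqr₁ z hz, hqr₂ z hz]
    rfl
  have hdecoded_closure := hdecoded.of_subset_closure
    ((Finset.continuous_restrict₂ hA).comp_continuousOn
      (hq₁.continuousOn.comp continuousOn_fst fun p hp => hp.2.1))
    ((Finset.continuous_restrict₂ hB).comp_continuousOn
      (hq₂.continuousOn.comp continuousOn_snd fun p hp => hp.2.2))
    hsub inter_subset_left
  rintro ⟨_, _⟩ hp
  obtain ⟨-, ⟨z, hz, rfl⟩, ⟨w, hw, rfl⟩⟩ := id hp
  refine (h₁.mem_jointRange_iff h₂ hz hw).2 fun i hi => ?_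
  have hzw := hdecoded_closure hp
  simp only [hqr₁ z hz, hqr₂ w hw] at hzw
  exact congrFun hzw ⟨i, hi⟩

variable [DecidableEq ι] {ι' : Type*} [DecidableEq ι'] {E' : ι' → Type*}
  [∀ i, NormedAddCommGroup (E' i)] [∀ i, NormedSpace ℝ (E' i)] {s' : ∀ i, Set (E' i)}
  {A' B' : Finset ι'} {r₁' : (∀ i, E' i) → F₁} {r₂' : (∀ i, E' i) → F₂}

theorem forall_mem_inter_eq_iff (h₁ : EncodesBlock s A r₁) (h₂ : EncodesBlock s B r₂)
    (h₁' : EncodesBlock s' A' r₁') (h₂' : EncodesBlock s' B' r₂')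
    (hjoint : jointRange (univ.pi s') r₁' r₂' = jointRange (univ.pi s) r₁ r₂)
    {z w : ∀ i, E i} (hz : z ∈ univ.pi s) (hw : w ∈ univ.pi s)
    {z' w' : ∀ i, E' i} (hz' : z' ∈ univ.pi s') (hw' : w' ∈ univ.pi s')
    (hzz' : r₁ z = r₁' z') (hww' : r₁ w = r₁' w') :
    (∀ i ∈ A ∩ B, z i = w i) ↔ ∀ i ∈ A' ∩ B', z' i = w' i := by
  rw [← h₁.exists_mem_jointRange_iff h₂ hz hw, ← h₁'.exists_mem_jointRange_iff h₂' hz' hw',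
    hjoint, hzz', hww']

theorem comp_eq_iff_of_jointRange_eq {G : Type*} [NormedAddCommGroup G] [NormedSpace ℝ G]
    (h₁ : EncodesBlock s A r₁) (h₂ : EncodesBlock s B r₂)
    (h₁' : EncodesBlock s' A' r₁') (h₂' : EncodesBlock s' B' r₂')
    (hjoint : jointRange (univ.pi s') r₁' r₂' = jointRange (univ.pi s) r₁ r₂)
    {γ : F₁ → G} (hγ : EncodesBlock s (A ∩ B) (γ ∘ r₁))
    {z' w' : ∀ i, E' i} (hz' : z' ∈ univ.pi s') (hw' : w' ∈ univ.pi s') :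
    γ (r₁' z') = γ (r₁' w') ↔ ∀ i ∈ A' ∩ B', z' i = w' i := by
  have hrange := image_eq_of_jointRange_eq hjoint
  obtain ⟨z, hz, hzz'⟩ := hrange.subset (mem_image_of_mem r₁' hz')
  obtain ⟨w, hw, hww'⟩ := hrange.subset (mem_image_of_mem r₁' hw')
  rw [← h₁.forall_mem_inter_eq_iff h₂ h₁' h₂' hjoint hz hw hz' hw' hzz' hww', ← hzz', ← hww']
  exact hγ.eq_iff hz hw

theorem comp_inter_of_jointRange_eq [Finite ι] [Finite ι'] {G : Type*} [NormedAddCommGroup G]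
    [NormedSpace ℝ G] (h₁ : EncodesBlock s A r₁) (h₂ : EncodesBlock s B r₂)
    (h₁' : EncodesBlock s' A' r₁') (h₂' : EncodesBlock s' B' r₂')
    (hjoint : jointRange (univ.pi s') r₁' r₂' = jointRange (univ.pi s) r₁ r₂)
    (hne : (univ.pi s).Nonempty) {γ : F₁ → G} (hγ : ContDiffOn ℝ ∞ γ (r₁ '' univ.pi s))
    (hγr : EncodesBlock s (A ∩ B) (γ ∘ r₁)) : EncodesBlock s' (A' ∩ B') (γ ∘ r₁') := by
  have := Fintype.ofFinite ι
  have := Fintype.ofFinite ι'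
  have hrange := image_eq_of_jointRange_eq hjoint
  have hrange_comp : γ ∘ r₁' '' univ.pi s' = γ ∘ r₁ '' univ.pi s := by
    rw [image_comp, hrange, ← image_comp]
  have hγ_iff {z' w' : ∀ i, E' i} (hz' : z' ∈ univ.pi s') (hw' : w' ∈ univ.pi s') :=
    h₁.comp_eq_iff_of_jointRange_eq h₂ h₁' h₂' hjoint hγr hz' hw'
  obtain ⟨σ, hσ, hσmaps, hσr⟩ := hγr.exists_section hne
  obtain ⟨q', hq', hqr'⟩ := h₁'.exists_decoder
  have hlift : MapsTo (fun y => r₁ (σ y)) (γ ∘ r₁ '' univ.pi s) (r₁' '' univ.pi s') :=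
    fun y hy => hrange.superset (mem_image_of_mem r₁ (hσmaps hy))
  have hdecode : ContDiffOn ℝ ∞ (fun y => q' (r₁ (σ y))) (γ ∘ r₁ '' univ.pi s) :=
    hq'.comp (h₁.contDiffOn.comp hσ hσmaps) hlift
  refine of_decoder (image_nonempty.1 (hrange ▸ hne.image r₁))
    (hγ.comp h₁'.contDiffOn fun z' hz' => hrange ▸ mem_image_of_mem r₁' hz')
    (fun z' hz' w' hw' => (hγ_iff hz' hw').2)
    (q := fun y => Finset.restrict₂ Finset.inter_subset_left (q' (r₁ (σ y)))) ?_
    fun z' hz' => ?_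
  · rw [hrange_comp]
    exact contDiffOn_pi.2 fun i => contDiffOn_pi.1 hdecode ⟨i, Finset.inter_subset_left i.2⟩
  · have hy : γ (r₁' z') ∈ γ ∘ r₁ '' univ.pi s := hrange_comp.subset (mem_image_of_mem _ hz')
    obtain ⟨w', hw', hww'⟩ := hlift hy
    have hagree := (hγ_iff hw' hz').1 (hww' ▸ hσr hy)
    ext ⟨i, hi⟩
    simp only [Function.comp_apply, ← hww', hqr' w' hw']
    exact hagree i hi

end Pair

end EncodesBlock

end EncodesBlock

theorem support_map_eq_closure_image {X Y : Type*} [TopologicalSpace X] [MeasurableSpace X]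
    [TopologicalSpace Y] [MeasurableSpace Y] [OpensMeasurableSpace Y] {μ : Measure X} {P : Set X}
    {f : X → Y} (hf : AEMeasurable f μ) (hcont : ContinuousOn f P) (hP : ∀ᵐ x ∂μ, x ∈ P)
    (hsupp : P ⊆ μ.support) : (μ.map f).support = closure (f '' P) := by
  refine Subset.antisymm (Measure.support_subset_of_isClosed isClosed_closure ?_)
    (closure_minimal ?_ Measure.isClosed_support)
  · refine (ae_map_iff hf isClosed_closure.measurableSet).2 ?_
    filter_upwards [hP] with x hx using subset_closure (mem_image_of_mem f hx)
  · rintro _ ⟨x, hx, rfl⟩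
    refine (nhds_basis_opens _).mem_measureSupport.2 fun U hU => ?_
    rw [Measure.map_apply_of_aemeasurable hf hU.2.measurableSet]
    obtain ⟨V, hV, hVU⟩ := mem_nhdsWithin_iff_exists_mem_nhds_inter.1
      ((hcont x hx).preimage_mem_nhdsWithin (hU.2.mem_nhds hU.1))
    calc 0 < μ V := (Measure.mem_support_iff_forall x).1 (hsupp hx) V hV
      _ ≤ μ (f ⁻¹' U) := measure_mono_ae (by
        filter_upwards [hP] with y hy hyV using hVU ⟨hyV, hy⟩)

namespace LatentModel

variable {N K : ℕ} {D : Fin K → ℕ}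

theorem latentSpace_nonempty (M : LatentModel N K D) : M.latentSpace.Nonempty := by
  have := M.simplyConnected_latent
  exact nonempty_coe_sort.1 (inferInstance : Nonempty (univ.pi M.factor))

theorem isOpen_factor (M : LatentModel N K D) (j : Fin N) : IsOpen (M.factor j) := by
  have h := isOpenMap_eval j _ M.isOpen_latent
  rwa [eval_image_univ_pi M.latentSpace_nonempty] at h

theorem image_view (M : LatentModel N K D) (k : Fin K) : M.view k '' M.latentSpace = M.X k := by
  rw [← (M.mixing_diffeo k).1.image_eq, ← image_restrict_univ_pi M.latentSpace_nonempty,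
    image_image]
  rfl

theorem image_comp_view (M : LatentModel N K D) (k : Fin K) {Y : Type*}
    (g : (Fin (D k) → ℝ) → Y) : (fun z => g (M.view k z)) '' M.latentSpace = g '' M.X k := by
  rw [← M.image_view k, image_image]

theorem ae_mem_latentSpace (M : LatentModel N K D) : ∀ᵐ z ∂M.latentLaw, z ∈ M.latentSpace :=
  (withDensity_absolutelyContinuous _ _).ae_le (ae_restrict_mem M.isOpen_latent.measurableSet)

theorem latentSpace_subset_support (M : LatentModel N K D) :
    M.latentSpace ⊆ M.latentLaw.support := by
  have hmeas : AEMeasurable (fun z => ENNReal.ofReal (M.density z))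
      (volume.restrict M.latentSpace) :=
    (M.density_smooth.continuousOn.aemeasurable M.isOpen_latent.measurableSet).ennreal_ofReal
  have hac : volume.restrict M.latentSpace ≪ M.latentLaw := by
    refine withDensity_absolutelyContinuous' hmeas ?_
    filter_upwards [M.density_pos] with z hz using (ENNReal.ofReal_pos.2 hz).ne'
  have hopen : IsOpen M.latentSpace := M.isOpen_latent
  calc M.latentSpace = interior M.latentSpace ∩ (volume : Measure (Fin N → ℝ)).support := by
        rw [Measure.support_eq_univ, inter_univ, hopen.interior_eq]
    _ ⊆ (volume.restrict M.latentSpace).support := Measure.interior_inter_support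
    _ ⊆ M.latentLaw.support := hac.support_mono

variable {M : LatentModel N K D} {k₁ k₂ : Fin K} {C₁ C₂ : Finset (Fin N)} {m₁ m₂ : ℕ}
  {g₁ : (Fin (D k₁) → ℝ) → (Fin m₁ → ℝ)} {g₂ : (Fin (D k₂) → ℝ) → (Fin m₂ → ℝ)}

theorem BlockIdentifies.encodesBlock (h : M.BlockIdentifies k₁ C₁ g₁) :
    EncodesBlock M.factor C₁ fun z => g₁ (M.view k₁ z) :=
  h.2.2

theorem support_reprLaw (h₁ : M.BlockIdentifies k₁ C₁ g₁) (h₂ : M.BlockIdentifies k₂ C₂ g₂) :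
    (M.reprLaw k₁ k₂ g₁ g₂).support =
      closure (jointRange M.latentSpace (fun z => g₁ (M.view k₁ z)) fun z => g₂ (M.view k₂ z)) := by
  have hcont : ContinuousOn (fun z => (g₁ (M.view k₁ z), g₂ (M.view k₂ z))) M.latentSpace :=
    h₁.encodesBlock.contDiffOn.continuousOn.prodMk h₂.encodesBlock.contDiffOn.continuousOn
  have hmeas : AEMeasurable (fun z => (g₁ (M.view k₁ z), g₂ (M.view k₂ z))) M.latentLaw :=
    (hcont.aemeasurable M.isOpen_latent.measurableSet).mono_ac
      (withDensity_absolutelyContinuous _ _)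
  exact support_map_eq_closure_image hmeas hcont M.ae_mem_latentSpace M.latentSpace_subset_support

theorem support_reprLaw_inter_prod (h₁ : M.BlockIdentifies k₁ C₁ g₁)
    (h₂ : M.BlockIdentifies k₂ C₂ g₂) :
    (M.reprLaw k₁ k₂ g₁ g₂).support ∩ (g₁ '' M.X k₁) ×ˢ (g₂ '' M.X k₂) =
      jointRange M.latentSpace (fun z => g₁ (M.view k₁ z)) fun z => g₂ (M.view k₂ z) := by
  rw [support_reprLaw h₁ h₂, ← image_comp_view, ← image_comp_view]
  exact h₁.encodesBlock.closure_jointRange_inter_prod h₂.encodesBlock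

theorem BlockIdentifies.exists_comp_of_subset (h : M.BlockIdentifies k₁ C₁ g₁) {C : Finset (Fin N)}
    (hC : C ⊆ C₁) : ∃ γ : (Fin m₁ → ℝ) → (Fin C.card → ℝ),
      ContDiffOn ℝ ∞ γ (g₁ '' M.X k₁) ∧ M.BlockIdentifies k₁ C (γ ∘ g₁) := by
  obtain ⟨γ, hγ, hγr⟩ := h.encodesBlock.exists_comp_of_subset hC
    (LinearEquiv.funCongrLeft ℝ ℝ C.equivFin.symm).toContinuousLinearEquiv
  replace hγ : ContDiffOn ℝ ∞ γ (g₁ '' M.X k₁) := M.image_comp_view k₁ g₁ ▸ hγ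
  exact ⟨γ, hγ, rfl, hγ.comp h.2.1 (mapsTo_image _ _), hγr⟩

variable {N' K' : ℕ} {D' : Fin K' → ℕ} {M' : LatentModel N' K' D'} {k₁' k₂' : Fin K'}
  {C₁' C₂' : Finset (Fin N')} {g₁' : (Fin (D' k₁') → ℝ) → (Fin m₁ → ℝ)}
  {g₂' : (Fin (D' k₂') → ℝ) → (Fin m₂ → ℝ)}

theorem jointRange_eq_of_reprLaw_eq
    (h₁ : M.BlockIdentifies k₁ C₁ g₁) (h₂ : M.BlockIdentifies k₂ C₂ g₂)
    (h₁' : M'.BlockIdentifies k₁' C₁' g₁') (h₂' : M'.BlockIdentifies k₂' C₂' g₂')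
    (hrange₁ : g₁' '' M'.X k₁' = g₁ '' M.X k₁) (hrange₂ : g₂' '' M'.X k₂' = g₂ '' M.X k₂)
    (hlaw : M'.reprLaw k₁' k₂' g₁' g₂' = M.reprLaw k₁ k₂ g₁ g₂) :
    jointRange M'.latentSpace (fun z => g₁' (M'.view k₁' z)) (fun z => g₂' (M'.view k₂' z)) =
      jointRange M.latentSpace (fun z => g₁ (M.view k₁ z)) fun z => g₂ (M.view k₂ z) := by
  rw [← support_reprLaw_inter_prod h₁ h₂, ← support_reprLaw_inter_prod h₁' h₂', hlaw, hrange₁,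
    hrange₂]

theorem BlockIdentifies.comp_inter_of_jointRange_eq
    (h₁ : M.BlockIdentifies k₁ C₁ g₁) (h₂ : M.BlockIdentifies k₂ C₂ g₂)
    (h₁' : M'.BlockIdentifies k₁' C₁' g₁') (h₂' : M'.BlockIdentifies k₂' C₂' g₂')
    (hjoint : jointRange M'.latentSpace (fun z => g₁' (M'.view k₁' z))
      (fun z => g₂' (M'.view k₂' z)) =
        jointRange M.latentSpace (fun z => g₁ (M.view k₁ z)) fun z => g₂ (M.view k₂ z))
    {m : ℕ} {γ : (Fin m₁ → ℝ) → (Fin m → ℝ)} (hγ : ContDiffOn ℝ ∞ γ (g₁ '' M.X k₁))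
    (hγg : M.BlockIdentifies k₁ (C₁ ∩ C₂) (γ ∘ g₁)) :
    M'.BlockIdentifies k₁' (C₁' ∩ C₂') (γ ∘ g₁') := by
  have hrange : g₁' '' M'.X k₁' = g₁ '' M.X k₁ := by
    rw [← image_comp_view, ← image_comp_view, image_eq_of_jointRange_eq hjoint]
  have hencodes : EncodesBlock M'.factor (C₁' ∩ C₂') fun z => γ (g₁' (M'.view k₁' z)) :=
    h₁.encodesBlock.comp_inter_of_jointRange_eq h₂.encodesBlock h₁'.encodesBlock h₂'.encodesBlock
      hjoint M.latentSpace_nonempty (M.image_comp_view k₁ g₁ ▸ hγ) hγg.encodesBlock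
  have hrange_comp : (fun z => (γ ∘ g₁) (M.view k₁ z)) '' M.latentSpace =
      (fun z => (γ ∘ g₁') (M'.view k₁' z)) '' M'.latentSpace := by
    rw [image_comp_view, image_comp_view, image_comp, image_comp, hrange]
  have hcard : (C₁ ∩ C₂).card = (C₁' ∩ C₂').card := by
    simpa only [Module.finrank_fintype_fun_eq_card, Fintype.card_coe] using
      hγg.encodesBlock.finrank_eq hencodes M.isOpen_factor M'.isOpen_factor
        M.latentSpace_nonempty hrange_comp
  exact ⟨hγg.1.trans hcard, hγ.comp h₁'.2.1 fun x hx => hrange ▸ mem_image_of_mem g₁' hx, hencodes⟩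

end LatentModel

theorem mainTheorem3 {N K : ℕ} {D : Fin K → ℕ} (M : LatentModel N K D)
    (k₁ k₂ : Fin K) (C₁ C₂ : Finset (Fin N)) {m₁ m₂ : ℕ}
    (g₁ : (Fin (D k₁) → ℝ) → (Fin m₁ → ℝ)) (g₂ : (Fin (D k₂) → ℝ) → (Fin m₂ → ℝ))
    (h₁ : M.BlockIdentifies k₁ C₁ g₁) (h₂ : M.BlockIdentifies k₂ C₂ g₂) :
    ∃ (γ₁ : (Fin m₁ → ℝ) → (Fin (C₁ ∩ C₂).card → ℝ))
      (γ₂ : (Fin m₂ → ℝ) → (Fin (C₁ ∩ C₂).card → ℝ)),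
      ContDiffOn ℝ ∞ γ₁ (g₁ '' M.X k₁) ∧ ContDiffOn ℝ ∞ γ₂ (g₂ '' M.X k₂) ∧
      M.BlockIdentifies k₁ (C₁ ∩ C₂) (γ₁ ∘ g₁) ∧
      M.BlockIdentifies k₂ (C₁ ∩ C₂) (γ₂ ∘ g₂) ∧
      -- the same `γ₁`, `γ₂` work in every model that explains the same representations,
      -- so that they are determined by the observable data alone
      ∀ (N' K' : ℕ) (D' : Fin K' → ℕ) (M' : LatentModel N' K' D')
        (k₁' k₂' : Fin K') (C₁' C₂' : Finset (Fin N'))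
        (g₁' : (Fin (D' k₁') → ℝ) → (Fin m₁ → ℝ)) (g₂' : (Fin (D' k₂') → ℝ) → (Fin m₂ → ℝ)),
        M'.BlockIdentifies k₁' C₁' g₁' → M'.BlockIdentifies k₂' C₂' g₂' →
        g₁' '' M'.X k₁' = g₁ '' M.X k₁ → g₂' '' M'.X k₂' = g₂ '' M.X k₂ →
        M'.reprLaw k₁' k₂' g₁' g₂' = M.reprLaw k₁ k₂ g₁ g₂ →
        M'.BlockIdentifies k₁' (C₁' ∩ C₂') (γ₁ ∘ g₁') ∧
        M'.BlockIdentifies k₂' (C₁' ∩ C₂') (γ₂ ∘ g₂') := by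
  obtain ⟨γ₁, hγ₁, hγg₁⟩ := h₁.exists_comp_of_subset (Finset.inter_subset_left (s₂ := C₂))
  obtain ⟨γ₂, hγ₂, hγg₂⟩ := h₂.exists_comp_of_subset (Finset.inter_subset_right (s₁ := C₁))
  refine ⟨γ₁, γ₂, hγ₁, hγ₂, hγg₁, hγg₂, ?_⟩
  intro N' K' D' M' k₁' k₂' C₁' C₂' g₁' g₂' h₁' h₂' hrange₁ hrange₂ hlaw
  have hjoint := LatentModel.jointRange_eq_of_reprLaw_eq h₁ h₂ h₁' h₂' hrange₁ hrange₂ hlaw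
  refine ⟨h₁.comp_inter_of_jointRange_eq h₂ h₁' h₂' hjoint hγ₁ hγg₁, ?_⟩
  rw [Finset.inter_comm C₁' C₂']
  refine h₂.comp_inter_of_jointRange_eq h₁ h₂' h₁' ?_ hγ₂ (Finset.inter_comm C₁ C₂ ▸ hγg₂)
  rw [← image_swap_jointRange, hjoint, image_swap_jointRange]
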